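/- Let $\mathcal{N}$ be a network: $n$ horizontal levels, labelled from bottom to top, and $m$ vertical segments (commutators) at distinct abscissae, labelled from left to right, each joining two consecutive levels. Its bricks are its bounded cells. A pseudoline is an abscissa monotone path on $\mathcal{N}$. A crossing of two pseudolines is a commutator traversed by both; a contact between two pseudolines is a commutator whose upper endpoint lies on one and whose lower endpoint lies on the other, and which neither traverses. A pseudoline arrangement supported by $\mathcal{N}$ is a set of $n$ pseudolines such that any two of them have precisely one crossing, possibly some contacts, and no other intersection; its $i$-th pseudoline is the one starting at level $i$. For a pseudoline arrangement $\Lambda$ supported by $\mathcal{N}$, the brick vector $\omega(\Lambda)\in\mathbb{R}^n$ is the vector whose $i$-th coordinate is the number of bricks of $\mathcal{N}$ located below the $i$-th pseudoline of $\Lambda$. The contact graph $\Lambda^\#$ is the directed multigraph with a node for each pseudoline of $\Lambda$ and an arc for each contact of $\Lambda$, oriented from the pseudoline passing above the contact to the pseudoline passing below it. The brick polytope is $\Omega(\mathcal{N})=\operatorname{conv}\{\omega(\Lambda') : \Lambda' \text{ a pseudoline arrangement supported by } \mathcal{N}\}\subset\mathbb{R}^n$. Then, for every network $\mathcal{N}$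 and every pseudoline arrangement $\Lambda$ supported by $\mathcal{N}$, the brick vector $\omega(\Lambda)$ is a vertex of $\Omega(\mathcal{N})$ if and only if $\Lambda^\#$ is acyclic, i.e. has no directed cycle. -/

import Mathlib

/-- A network: `n` horizontal levels, numbered from bottom to top, and `m` vertical commutators,
numbered from left to right, the `k`-th one joining the consecutive levels `lower k` and `upper k`.
The commutators have pairwise distinct abscissae. -/
structure Network (n m : ℕ) where
  lower : Fin m → Fin n
  upper : Fin m → Fin n
  upper_eq : ∀ k, (upper k : ℕ) = (lower k : ℕ) + 1

namespace Network

variable {n m : ℕ}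

/-- A pseudoline: an abscissa monotone path on the network. The `m` commutators cut the abscissa
axis into `m + 1` intervals; `level t` is the level on which the path runs in the interval `t`.
The intervals just before and just after the commutator `k` are `k.castSucc` and `k.succ`. At `k`
the path either stays on its level, or traverses the commutator, upwards or downwards. -/
structure Pseudoline (N : Network n m) where
  level : Fin (m + 1) → Fin n
  step : ∀ k : Fin m,
    level k.succ = level k.castSucc ∨
    (level k.castSucc = N.lower k ∧ level k.succ = N.upper k) ∨
    (level k.castSucc = N.upper k ∧ level k.succ = N.lower k)

/-- The path traverses the commutator `k`. -/
def Pseudoline.Traverses {N : Network n m} (p : N.Pseudoline) (k : Fin m) : Prop :=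
  (p.level k.castSucc = N.lower k ∧ p.level k.succ = N.upper k) ∨
  (p.level k.castSucc = N.upper k ∧ p.level k.succ = N.lower k)

/-- A pseudoline arrangement (with contacts): `n` pseudolines, any two of which have precisely one
crossing (a commutator traversed by both), possibly some contacts, and no other intersection (they
never run on the same level at the same abscissa). The pseudolines are labelled by the level on
which they start. -/
structure Arrangement (N : Network n m) where
  line : Fin n → N.Pseudoline
  start : ∀ i, (line i).level 0 = i
  disjoint : ∀ i j, i ≠ j → ∀ t, (line i).level t ≠ (line j).level t
  crossing : ∀ i j, i ≠ j → ∃! k : Fin m, (line i).Traverses k ∧ (line j).Traverses k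

/-- The bricks (bounded cells) of the network, each given by the pair of commutators that bound it
on the left and on the right: two commutators between the same two consecutive levels, with no
other commutator between these two levels in between. -/
def IsBrick (N : Network n m) (b : Fin m × Fin m) : Prop :=
  b.1 < b.2 ∧ N.lower b.1 = N.lower b.2 ∧
    ∀ k, b.1 < k → k < b.2 → N.lower k ≠ N.lower b.1

/-- The brick `b` is located below the pseudoline `p`: in all the intervals of abscissae over which
the brick extends, `p` runs on or above the upper side of the brick. -/
def Pseudoline.IsAbove {N : Network n m} (p : N.Pseudoline) (b : Fin m × Fin m) : Prop :=
  ∀ t : Fin (m + 1), b.1.castSucc < t → t ≤ b.2.castSucc → N.upper b.1 ≤ p.level t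

/-- The brick vector: its `i`-th coordinate is the number of bricks of the network located below
the `i`-th pseudoline. -/
noncomputable def Arrangement.brickVector {N : Network n m} (Λ : N.Arrangement) : Fin n → ℝ :=
  fun i => ({b : Fin m × Fin m | N.IsBrick b ∧ (Λ.line i).IsAbove b}.ncard : ℝ)

/-- The brick polytope: the convex hull of the brick vectors of all the pseudoline arrangements
supported by the network. -/
def brickPolytope (N : Network n m) : Set (Fin n → ℝ) :=
  convexHull ℝ (Set.range fun Λ : N.Arrangement => Λ.brickVector)

/-- The commutator `k` is a contact between the `i`-th pseudoline, passing above it, and the `j`-th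
pseudoline, passing below it: neither of them traverses `k`, the `i`-th one runs through its upper
endpoint and the `j`-th one through its lower endpoint. -/
def Arrangement.IsContact {N : Network n m} (Λ : N.Arrangement) (k : Fin m) (i j : Fin n) : Prop :=
  ((Λ.line i).level k.castSucc = N.upper k ∧ (Λ.line i).level k.succ = N.upper k) ∧
  ((Λ.line j).level k.castSucc = N.lower k ∧ (Λ.line j).level k.succ = N.lower k)

/-- The contact graph: the directed multigraph with a node for each pseudoline and an arc for each
contact, oriented from the pseudoline passing above the contact to the one passing below it. -/
@[reducible] def Arrangement.contactGraph {N : Network n m} (Λ : N.Arrangement) : Quiver (Fin n) where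
  Hom i j := {k : Fin m // Λ.IsContact k i j}

end Network

/-- A directed multigraph is acyclic if it has no directed cycle: every directed path from a node
to itself is the trivial one. -/
def Quiver.IsAcyclic {V : Type*} (G : Quiver V) : Prop :=
  ∀ (v : V) (p : @Quiver.Path V G v v), p.length = 0

/-!
Acyclicity of the contact graph characterizes the vertices of the brick polytope. Everything rests
on flips: if the pseudolines `a` and `b` cross at `c` and also meet at `k`, exchanging them
between `k` and `c` gives another arrangement, in which they cross at `k` and have a contact at
`c` (`Arrangement.exists_isFlip`). When `k` is a contact with `a` above `b`, this takes the bricks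
between `a` and `b` over that interval, of which there is at least one, away from `a` and gives
them to `b`: the brick vector changes by a positive multiple of `e_b - e_a`
(`Arrangement.exists_brickVector_eq_add`).

If the contact graph has a directed cycle, the directions of its arcs have a vanishing positive
combination, so the brick vector is a proper convex combination of other points of the polytope.

If the contact graph is acyclic, it has a topological sorting `f`, and the claim is that the brick
vector is the only one that minimizes the linear functional `∑ i, f i * x i`. A flip of a contact
along which `f` decreases would lower the functional, so `f` increases along the contact graph of
every minimizing arrangement: such an arrangement is sorted by `f`. It remains to see that at most
one arrangement is sorted by `f` (`Arrangement.Sorted.eq`). For `f = 1` it is the greedy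
arrangement, where two pseudolines cross as soon as they meet. If uniqueness holds for one order,
it holds for the order obtained by exchanging two consecutive values, taken at `a` and `b` say:
all contacts between `a` and `b` have the same direction, the flip that moves their crossing to
the other extreme reverses them all, and an arrangement is recovered from its flip
(`Arrangement.Sorted.eq_of_mul_swap`). Exchanges of consecutive values generate all permutations.
-/

/-! ### Relative positions of pseudolines -/

namespace Network

variable {n m : ℕ} {N : Network n m}

theorem Pseudoline.upper_le_level_succ_iff (p : N.Pseudoline) {q k : Fin m}
    (h : N.lower k ≠ N.lower q) :
    N.upper q ≤ p.level k.succ ↔ N.upper q ≤ p.level k.castSucc := by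
  have h1 := N.upper_eq q
  have h2 := N.upper_eq k
  have h3 := p.step k
  simp only [Fin.ext_iff, Fin.le_def, ne_eq] at *
  omega

theorem Pseudoline.upper_le_level_iff (p : N.Pseudoline) {q : Fin m} {t : Fin (m + 1)}
    (hq : q.castSucc < t)
    (h : ∀ k : Fin m, q < k → k.castSucc < t → N.lower k ≠ N.lower q) :
    N.upper q ≤ p.level t ↔ N.upper q ≤ p.level q.succ := by
  induction t using Fin.induction with
  | zero => exact absurd hq (Fin.not_lt_zero _)
  | succ k ih =>
    rcases (Fin.castSucc_lt_succ_iff.1 hq).eq_or_lt with rfl | hqk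
    · rfl
    · rw [p.upper_le_level_succ_iff (h k hqk (Fin.castSucc_lt_succ))]
      exact ih (Fin.castSucc_lt_castSucc_iff.2 hqk)
        fun k' h1 h2 => h k' h1 (h2.trans (Fin.castSucc_lt_succ))

/-- A pseudoline cannot enter or leave the region above a brick between the two commutators that
bound the brick, so its position just after the left one decides. -/
theorem Pseudoline.isAbove_iff (p : N.Pseudoline) {b : Fin m × Fin m} (hb : N.IsBrick b) :
    p.IsAbove b ↔ N.upper b.1 ≤ p.level b.1.succ := by
  obtain ⟨hlt, -, hno⟩ := hb
  constructor
  · intro h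
    exact h _ (Fin.castSucc_lt_succ) (Fin.succ_le_castSucc_iff.2 hlt)
  · intro h t h1 h2
    refine (p.upper_le_level_iff h1 fun k hk hkt => hno k hk ?_).2 h
    exact Fin.castSucc_lt_castSucc_iff.1 (hkt.trans_le h2)

/-- Two disjoint pseudolines both traverse `k` exactly if their relative position changes at `k`. -/
theorem Pseudoline.traverses_and_traverses_iff (p q : N.Pseudoline) (k : Fin m)
    (h1 : p.level k.castSucc ≠ q.level k.castSucc) (h2 : p.level k.succ ≠ q.level k.succ) :
    p.Traverses k ∧ q.Traverses k ↔
      ((p.level k.castSucc < q.level k.castSucc) ↔ ¬ p.level k.succ < q.level k.succ) := by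
  have := p.step k
  have := q.step k
  have := N.upper_eq k
  unfold Traverses
  simp only [Fin.ext_iff, Fin.lt_def, ne_eq] at *
  omega

/-- The relative position of two pseudolines `p` and `q`, labelled `i` and `j` in the order in which
they start, is reversed at the commutator `c` and nowhere else. -/
def CrossAt (p q : N.Pseudoline) (i j : Fin n) (c : Fin m) : Prop :=
  ∀ t, p.level t < q.level t ↔ (i < j ↔ t ≤ c.castSucc)

theorem CrossAt.symm {p q : N.Pseudoline} {i j : Fin n} {c : Fin m} (hij : i ≠ j)
    (hd : ∀ t, p.level t ≠ q.level t) (h : CrossAt p q i j c) : CrossAt q p j i c := by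
  intro t
  have h1 := h t
  have h2 := hd t
  simp only [Fin.ext_iff, Fin.lt_def, ne_eq] at *
  omega

theorem CrossAt.existsUnique {p q : N.Pseudoline} {i j : Fin n} {c : Fin m}
    (hd : ∀ t, p.level t ≠ q.level t) (h : CrossAt p q i j c) :
    ∃! k : Fin m, p.Traverses k ∧ q.Traverses k := by
  have key : ∀ k, p.Traverses k ∧ q.Traverses k ↔ k = c := by
    intro k
    rw [p.traverses_and_traverses_iff q k (hd _) (hd _), h, h]
    simp only [Fin.ext_iff, Fin.lt_def, Fin.le_def, Fin.val_castSucc, Fin.val_succ]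
    omega
  exact ⟨c, (key c).2 rfl, fun k hk => (key k).1 hk⟩

theorem CrossAt.unique {p q : N.Pseudoline} {i j : Fin n} {c c' : Fin m}
    (h : CrossAt p q i j c) (h' : CrossAt p q i j c') : c = c' := by
  have h1 := (h c.succ).symm.trans (h' c.succ)
  have h2 := (h c'.succ).symm.trans (h' c'.succ)
  simp only [Fin.ext_iff, Fin.lt_def, Fin.le_def, Fin.val_castSucc, Fin.val_succ] at *
  omega

theorem Pseudoline.ext_level {p q : N.Pseudoline} (h : ∀ t, p.level t = q.level t) : p = q := by
  obtain ⟨l, _⟩ := p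
  obtain ⟨l', _⟩ := q
  obtain rfl : l = l' := funext h
  rfl

namespace Arrangement

theorem ext_level {Λ Λ' : N.Arrangement}
    (h : ∀ i t, (Λ.line i).level t = (Λ'.line i).level t) : Λ = Λ' := by
  obtain ⟨l, _, _, _⟩ := Λ
  obtain ⟨l', _, _, _⟩ := Λ'
  obtain rfl : l = l' := funext fun i => Pseudoline.ext_level (h i)
  rfl

instance : Finite N.Arrangement :=
  Finite.of_injective (fun Λ i t => (Λ.line i).level t) fun _ _ h =>
    ext_level fun i t => congrFun (congrFun h i) t

variable (Λ : N.Arrangement)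

theorem exists_crossAt {i j : Fin n} (hij : i ≠ j) :
    ∃ c, CrossAt (Λ.line i) (Λ.line j) i j c := by
  obtain ⟨c, hc, huniq⟩ := Λ.crossing i j hij
  refine ⟨c, fun t => ?_⟩
  induction t using Fin.induction with
  | zero => simp [Λ.start]
  | succ k ih =>
    have hk : (Λ.line i).Traverses k ∧ (Λ.line j).Traverses k ↔ k = c :=
      ⟨fun h => huniq k h, fun h => h ▸ hc⟩
    rw [Pseudoline.traverses_and_traverses_iff _ _ _ (Λ.disjoint i j hij _)
      (Λ.disjoint i j hij _)] at hk
    simp only [Fin.ext_iff, Fin.lt_def, Fin.le_def, Fin.val_castSucc, Fin.val_succ] at *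
    omega

theorem level_injective (t : Fin (m + 1)) : Function.Injective fun i => (Λ.line i).level t := by
  intro i j h
  by_contra hij
  exact Λ.disjoint i j hij t h

/-- Two pseudolines meet at the commutator `k` if they run just before `k` on the two levels that
`k` joins: then `k` is either their crossing or a contact between them. -/
def Meets (a b : Fin n) (k : Fin m) : Prop :=
  ((Λ.line a).level k.castSucc = N.upper k ∧ (Λ.line b).level k.castSucc = N.lower k) ∨
  ((Λ.line a).level k.castSucc = N.lower k ∧ (Λ.line b).level k.castSucc = N.upper k)

variable {Λ}

theorem Meets.symm {a b : Fin n} {k : Fin m} (h : Λ.Meets a b k) : Λ.Meets b a k := by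
  unfold Meets at *
  tauto

theorem Meets.ne {a b : Fin n} {k : Fin m} (h : Λ.Meets a b k) : a ≠ b := by
  rintro rfl
  have := N.upper_eq k
  unfold Meets at h
  simp only [Fin.ext_iff] at h
  omega

theorem Meets.eq_or_eq {a b x : Fin n} {k : Fin m} (h : Λ.Meets a b k)
    (hx : (Λ.line x).level k.castSucc = N.upper k ∨ (Λ.line x).level k.castSucc = N.lower k) :
    x = a ∨ x = b := by
  have inj := Λ.level_injective k.castSucc
  unfold Meets at h
  rcases h with ⟨h1, h2⟩ | ⟨h1, h2⟩ <;> rcases hx with hx | hx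
  · exact .inl (inj (hx.trans h1.symm))
  · exact .inr (inj (hx.trans h2.symm))
  · exact .inr (inj (hx.trans h2.symm))
  · exact .inl (inj (hx.trans h1.symm))

theorem Meets.succ {a b : Fin n} {k : Fin m} (h : Λ.Meets a b k) :
    ((Λ.line a).level k.succ = N.upper k ∧ (Λ.line b).level k.succ = N.lower k) ∨
    ((Λ.line a).level k.succ = N.lower k ∧ (Λ.line b).level k.succ = N.upper k) := by
  have := Λ.disjoint a b h.ne k.succ
  have := (Λ.line a).step k
  have := (Λ.line b).step k
  have := N.upper_eq k
  unfold Meets at h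
  simp only [Fin.ext_iff, ne_eq] at *
  omega

theorem meets_of_crossAt {a b : Fin n} {c : Fin m} (hab : a ≠ b)
    (hc : CrossAt (Λ.line a) (Λ.line b) a b c) : Λ.Meets a b c := by
  have := Λ.disjoint a b hab c.castSucc
  have := Λ.disjoint a b hab c.succ
  have := (Λ.line a).step c
  have := (Λ.line b).step c
  have := N.upper_eq c
  have := hc c.castSucc
  have := hc c.succ
  unfold Meets
  simp only [Fin.ext_iff, ne_eq, Fin.lt_def, Fin.le_def, Fin.val_castSucc, Fin.val_succ] at *
  omega

/-- The direction of a contact is determined by its position relative to the crossing: before it,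
the pseudoline that starts higher is above, and after it, the other one. -/
theorem isContact_iff {a b : Fin n} {c q : Fin m} (hab : a ≠ b)
    (hc : CrossAt (Λ.line a) (Λ.line b) a b c) :
    Λ.IsContact q a b ↔ Λ.Meets a b q ∧ q ≠ c ∧ (b < a ↔ q < c) := by
  have := Λ.disjoint a b hab q.castSucc
  have := Λ.disjoint a b hab q.succ
  have := (Λ.line a).step q
  have := (Λ.line b).step q
  have := N.upper_eq q
  have := hc q.castSucc
  have := hc q.succ
  unfold Meets IsContact
  simp only [Fin.ext_iff, ne_eq, Fin.lt_def, Fin.le_def, Fin.val_castSucc, Fin.val_succ] at *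
  omega

theorem IsContact.meets {a b : Fin n} {q : Fin m} (h : Λ.IsContact q a b) : Λ.Meets a b q :=
  .inl ⟨h.1.1, h.2.1⟩

/-- A third pseudoline runs above both of two pseudolines that meet at `k`, or below both. -/
theorem Meets.lt_iff_lt {a b l : Fin n} {k : Fin m} (h : Λ.Meets a b k) (ha : l ≠ a) (hb : l ≠ b) :
    ((Λ.line l).level k.castSucc < (Λ.line a).level k.castSucc ↔
      (Λ.line l).level k.castSucc < (Λ.line b).level k.castSucc) ∧
    ((Λ.line l).level k.succ < (Λ.line a).level k.succ ↔
      (Λ.line l).level k.succ < (Λ.line b).level k.succ) := by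
  have := Λ.disjoint l a ha k.castSucc
  have := Λ.disjoint l b hb k.castSucc
  have := Λ.disjoint l a ha k.succ
  have := Λ.disjoint l b hb k.succ
  have := N.upper_eq k
  have := h.succ
  unfold Meets at h
  simp only [Fin.ext_iff, ne_eq, Fin.lt_def] at *
  omega

end Arrangement
end Network

/-! ### Flips -/

namespace Network

variable {n m : ℕ} {N : Network n m}

/-- The relabelling that exchanges `a` and `b` at the abscissae between the commutators `k` and `c`,
in whichever order these are, and is the identity elsewhere. The interval just after the left one of
the two commutators is included, as is the interval just before the right one. -/
def tailSwap (a b : Fin n) (k c : Fin m) (t : Fin (m + 1)) : Equiv.Perm (Fin n) :=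
  if (min k c).castSucc < t ∧ t ≤ (max k c).castSucc then Equiv.swap a b else 1

theorem tailSwap_eq_one_or_swap (a b : Fin n) (k c : Fin m) (t : Fin (m + 1)) :
    tailSwap a b k c t = 1 ∨ tailSwap a b k c t = Equiv.swap a b := by
  unfold tailSwap
  split_ifs <;> simp

theorem tailSwap_tailSwap (a b : Fin n) (k c : Fin m) (t : Fin (m + 1)) (x : Fin n) :
    tailSwap a b k c t (tailSwap a b k c t x) = x := by
  rcases tailSwap_eq_one_or_swap a b k c t with h | h <;> simp [h]

theorem tailSwap_zero (a b : Fin n) (k c : Fin m) : tailSwap a b k c 0 = 1 := by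
  simp [tailSwap]

theorem tailSwap_last (a b : Fin n) (k c : Fin m) : tailSwap a b k c (Fin.last m) = 1 := by
  have h : ¬ Fin.last m ≤ (max k c).castSucc := (Fin.castSucc_lt_last _).not_ge
  simp [tailSwap, h]

theorem tailSwap_apply_of_ne {a b x : Fin n} (ha : x ≠ a) (hb : x ≠ b) (k c : Fin m)
    (t : Fin (m + 1)) : tailSwap a b k c t x = x := by
  rcases tailSwap_eq_one_or_swap a b k c t with h | h <;>
    simp [h, Equiv.swap_apply_of_ne_of_ne ha hb]

theorem tailSwap_succ_eq {a b : Fin n} {k c q : Fin m} (hk : q ≠ k) (hc : q ≠ c) :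
    tailSwap a b k c q.succ = tailSwap a b k c q.castSucc := by
  unfold tailSwap
  congr 1
  simp only [Fin.ext_iff, ne_eq, Fin.lt_def, Fin.le_def, Fin.val_castSucc, Fin.val_succ,
    eq_iff_iff, Fin.coe_min, Fin.coe_max] at *
  omega

namespace Arrangement

/-- `Λ'` is obtained from `Λ` by exchanging the two pseudolines `a` and `b` between the
commutators `k` and `c`. -/
def IsFlip (Λ Λ' : N.Arrangement) (a b : Fin n) (k c : Fin m) : Prop :=
  ∀ l t, (Λ'.line l).level t = (Λ.line (tailSwap a b k c t l)).level t

variable {Λ Λ' : N.Arrangement} {a b : Fin n} {k c : Fin m}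

theorem crossAt_comm {i j : Fin n} (hij : i ≠ j) :
    CrossAt (Λ.line i) (Λ.line j) i j c ↔ CrossAt (Λ.line j) (Λ.line i) j i c :=
  ⟨.symm hij (Λ.disjoint i j hij), .symm hij.symm (Λ.disjoint j i hij.symm)⟩

/-- After the exchange of `a` and `b` between `k` and `c`, every pseudoline is still a path on the
network: the switch between the paths takes place at `k` and `c`, where `a` and `b` meet. -/
theorem flip_step (hc : CrossAt (Λ.line a) (Λ.line b) a b c) (hk : Λ.Meets a b k)
    (l : Fin n) (q : Fin m) :
    (Λ.line (tailSwap a b k c q.succ l)).level q.succ =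
      (Λ.line (tailSwap a b k c q.castSucc l)).level q.castSucc ∨
    ((Λ.line (tailSwap a b k c q.castSucc l)).level q.castSucc = N.lower q ∧
      (Λ.line (tailSwap a b k c q.succ l)).level q.succ = N.upper q) ∨
    ((Λ.line (tailSwap a b k c q.castSucc l)).level q.castSucc = N.upper q ∧
      (Λ.line (tailSwap a b k c q.succ l)).level q.succ = N.lower q) := by
  by_cases hq : q = k ∨ q = c
  · have hm : Λ.Meets a b q := by
      rcases hq with rfl | rfl
      exacts [hk, meets_of_crossAt hk.ne hc]
    by_cases hl : l = a ∨ l = b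
    · have key : ∀ t, tailSwap a b k c t l = a ∨ tailSwap a b k c t l = b := by
        intro t
        rcases tailSwap_eq_one_or_swap a b k c t with h | h <;> rcases hl with rfl | rfl <;>
          simp [h]
      have hs := hm.succ
      unfold Meets at hm
      rcases key q.succ with h1 | h1 <;> rcases key q.castSucc with h2 | h2 <;>
        rw [h1, h2] <;> rcases hm with hm | hm <;> rcases hs with hs | hs <;> simp [hm, hs]
    · push Not at hl
      rw [tailSwap_apply_of_ne hl.1 hl.2, tailSwap_apply_of_ne hl.1 hl.2]
      exact (Λ.line l).step q
  · push Not at hq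
    rw [tailSwap_succ_eq hq.1 hq.2]
    exact (Λ.line _).step q

/-- Between `k` and `c`, a third pseudoline `l` crosses both of `a` and `b` or neither, since it
runs on the same side of both at `k` and at `c`. -/
theorem exists_crossAt_flip_of_ne (hc : CrossAt (Λ.line a) (Λ.line b) a b c)
    (hk : Λ.Meets a b k) {l : Fin n} (ha : l ≠ a) (hb : l ≠ b) :
    ∃ d : Fin m, ∀ t, (Λ.line l).level t < (Λ.line (tailSwap a b k c t a)).level t ↔
      (l < a ↔ t ≤ d.castSucc) := by
  obtain ⟨da, hda⟩ := Λ.exists_crossAt ha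
  obtain ⟨db, hdb⟩ := Λ.exists_crossAt hb
  obtain ⟨h1, h2⟩ := hk.lt_iff_lt ha hb
  obtain ⟨h3, h4⟩ := (meets_of_crossAt hk.ne hc).lt_iff_lt ha hb
  rw [hda, hdb] at h1 h2 h3 h4
  have hA : ∀ t, (Λ.line l).level t < (Λ.line (tailSwap a b k c t a)).level t ↔
      if (min k c).castSucc < t ∧ t ≤ (max k c).castSucc then (l < b ↔ t ≤ db.castSucc)
      else (l < a ↔ t ≤ da.castSucc) := by
    intro t
    unfold tailSwap
    split_ifs
    · rw [Equiv.swap_apply_left, hdb]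
    · exact hda t
  -- The exchanged pseudoline crosses `l` where `b` does if that is between `k` and `c`, and where
  -- `a` does otherwise.
  refine ⟨if min k c < da ∧ da < max k c then db else da, fun t => (hA t).trans ?_⟩
  split_ifs <;>
  simp only [Fin.ext_iff, ne_eq, Fin.lt_def, Fin.le_def, Fin.val_castSucc, Fin.val_succ,
    Fin.coe_min, Fin.coe_max] at * <;> omega

theorem flip_crossAt_left (hc : CrossAt (Λ.line a) (Λ.line b) a b c) (hab : a ≠ b)
    (t : Fin (m + 1)) :
    (Λ.line (tailSwap a b k c t a)).level t < (Λ.line (tailSwap a b k c t b)).level t ↔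
      (a < b ↔ t ≤ k.castSucc) := by
  have h1 := hc t
  have h2 := Λ.disjoint a b hab t
  unfold tailSwap
  split_ifs <;> simp only [Equiv.swap_apply_left, Equiv.swap_apply_right, Equiv.Perm.one_apply] <;>
  simp only [Fin.ext_iff, ne_eq, Fin.lt_def, Fin.le_def, Fin.val_castSucc, Fin.coe_min,
    Fin.coe_max] at * <;> omega

theorem tailSwap_comm (a b : Fin n) (k c : Fin m) : tailSwap a b k c = tailSwap b a k c := by
  funext t
  simp [tailSwap, Equiv.swap_comm]

/-- Two pseudolines can be exchanged between their crossing and any other commutator at which they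
meet: the result is again an arrangement. -/
theorem exists_isFlip (hc : CrossAt (Λ.line a) (Λ.line b) a b c) (hk : Λ.Meets a b k) :
    ∃ Λ' : N.Arrangement, Λ.IsFlip Λ' a b k c := by
  let line' : Fin n → N.Pseudoline := fun l =>
    ⟨fun t => (Λ.line (tailSwap a b k c t l)).level t, flip_step hc hk l⟩
  have hd : ∀ i j, i ≠ j → ∀ t, (line' i).level t ≠ (line' j).level t := fun i j hij t =>
    Λ.disjoint _ _ (fun h => hij ((tailSwap a b k c t).injective h)) t
  have hab := hk.ne
  have hthird : ∀ i j, i ≠ j → i ≠ a → i ≠ b → ∃ d, CrossAt (line' i) (line' j) i j d := by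
    intro i j hij hia hib
    by_cases hja : j = a
    · subst hja
      obtain ⟨d, hd⟩ := exists_crossAt_flip_of_ne hc hk hia hib
      refine ⟨d, fun t => ?_⟩
      rw [← hd t]
      simp only [line', tailSwap_apply_of_ne hia hib]
    · by_cases hjb : j = b
      · subst hjb
        obtain ⟨d, hd⟩ := exists_crossAt_flip_of_ne ((crossAt_comm hab).1 hc) hk.symm hib hia
        refine ⟨d, fun t => ?_⟩
        rw [← hd t, ← tailSwap_comm a]
        simp only [line', tailSwap_apply_of_ne hia hib]
      · obtain ⟨d, hd⟩ := Λ.exists_crossAt hij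
        refine ⟨d, fun t => ?_⟩
        rw [← hd t]
        simp only [line', tailSwap_apply_of_ne hia hib, tailSwap_apply_of_ne hja hjb]
  have hcross : ∀ i j, i ≠ j → ∃ d, CrossAt (line' i) (line' j) i j d := by
    intro i j hij
    by_cases hi : i ≠ a ∧ i ≠ b
    · exact hthird i j hij hi.1 hi.2
    by_cases hj : j ≠ a ∧ j ≠ b
    · obtain ⟨d, hd'⟩ := hthird j i hij.symm hj.1 hj.2
      exact ⟨d, hd'.symm hij.symm (hd j i hij.symm)⟩
    have h1 : CrossAt (line' a) (line' b) a b k := flip_crossAt_left hc hab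
    obtain ⟨rfl, rfl⟩ | ⟨rfl, rfl⟩ : (i = a ∧ j = b) ∨ (i = b ∧ j = a) := by grind
    · exact ⟨k, h1⟩
    · exact ⟨k, h1.symm hab (hd _ _ hab)⟩
  refine ⟨⟨line', fun i => ?_, hd, fun i j hij => ?_⟩, fun l t => rfl⟩
  · simp [line', tailSwap_zero, Λ.start]
  · obtain ⟨d, hd'⟩ := hcross i j hij
    exact hd'.existsUnique (hd i j hij)

namespace IsFlip

theorem crossAt (h : Λ.IsFlip Λ' a b k c) (hab : a ≠ b)
    (hc : CrossAt (Λ.line a) (Λ.line b) a b c) : CrossAt (Λ'.line a) (Λ'.line b) a b k := by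
  intro t
  rw [h, h]
  exact flip_crossAt_left hc hab t

theorem meets_iff (h : Λ.IsFlip Λ' a b k c) (q : Fin m) : Λ'.Meets a b q ↔ Λ.Meets a b q := by
  unfold Meets
  rw [h, h]
  rcases tailSwap_eq_one_or_swap a b k c q.castSucc with h | h <;> simp [h]
  tauto

theorem symm (h : Λ.IsFlip Λ' a b k c) : Λ'.IsFlip Λ a b k c := by
  intro l t
  rw [h, tailSwap_tailSwap]

/-- A contact of the flipped arrangement is a contact between the two exchanged pseudolines, or a
contact of the original arrangement, up to the exchange of the two labels. -/
theorem isContact (h : Λ.IsFlip Λ' a b k c) (hc : CrossAt (Λ.line a) (Λ.line b) a b c)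
    (hk : Λ.Meets a b k) {q : Fin m} {x y : Fin n} (hq : Λ'.IsContact q x y) :
    (x = a ∧ y = b) ∨ (x = b ∧ y = a) ∨ Λ.IsContact q x y ∨
      Λ.IsContact q (Equiv.swap a b x) (Equiv.swap a b y) := by
  by_cases hqk : q = k ∨ q = c
  · have hm : Λ'.Meets a b q := by
      rw [h.meets_iff]
      rcases hqk with rfl | rfl
      exacts [hk, meets_of_crossAt hk.ne hc]
    have hx := hm.eq_or_eq (.inl hq.1.1)
    have hy := hm.eq_or_eq (.inr hq.2.1)
    have := hq.meets.ne
    grind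
  · push Not at hqk
    unfold IsContact at *
    rw [h, h, h, h, tailSwap_succ_eq hqk.1 hqk.2] at hq
    rcases tailSwap_eq_one_or_swap a b k c q.castSucc with e | e <;> rw [e] at hq
    · exact .inr (.inr (.inl hq))
    · exact .inr (.inr (.inr hq))

end IsFlip
end Arrangement
end Network

/-! ### Sorted arrangements -/

namespace Network

variable {n m : ℕ} {N : Network n m}

namespace Arrangement

/-- An arrangement is sorted by `f` if `f` increases along all the arcs of its contact graph. -/
def Sorted (Λ : N.Arrangement) (f : Equiv.Perm (Fin n)) : Prop :=
  ∀ k i j, Λ.IsContact k i j → f i < f j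

variable {Λ Λ' : N.Arrangement}

/-- In an arrangement sorted by the identity, every two pseudolines cross as soon as they meet. -/
theorem Sorted.level_succ (h : Λ.Sorted 1) {x y : Fin n} {q : Fin m} (hxy : x < y)
    (hm : Λ.Meets x y q) :
    (Λ.line x).level q.succ = N.upper q ∧ (Λ.line y).level q.succ = N.lower q := by
  obtain ⟨c, hc⟩ := Λ.exists_crossAt hxy.ne
  have hcq : c ≤ q := by
    by_contra! hlt
    have := h q y x
      ((isContact_iff hxy.ne' ((crossAt_comm hxy.ne).1 hc)).2 ⟨hm.symm, hlt.ne, by simp [hxy, hlt]⟩)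
    exact this.not_gt hxy
  have h1 := hc q.succ
  have h2 := hm.succ
  have := N.upper_eq q
  simp only [Fin.ext_iff, Fin.lt_def, Fin.le_def, Fin.val_castSucc, Fin.val_succ] at *
  omega

theorem level_succ_of_ne (Λ : N.Arrangement) {l : Fin n} {q : Fin m}
    (h1 : (Λ.line l).level q.castSucc ≠ N.upper q) (h2 : (Λ.line l).level q.castSucc ≠ N.lower q) :
    (Λ.line l).level q.succ = (Λ.line l).level q.castSucc := by
  have := (Λ.line l).step q
  tauto

theorem exists_meets (Λ : N.Arrangement) {l : Fin n} {q : Fin m}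
    (h : (Λ.line l).level q.castSucc = N.upper q ∨ (Λ.line l).level q.castSucc = N.lower q) :
    ∃ l', Λ.Meets l l' q := by
  have hs := Finite.surjective_of_injective (Λ.level_injective q.castSucc)
  rcases h with h | h
  · obtain ⟨l', hl'⟩ := hs (N.lower q)
    exact ⟨l', .inl ⟨h, hl'⟩⟩
  · obtain ⟨l', hl'⟩ := hs (N.upper q)
    exact ⟨l', .inr ⟨h, hl'⟩⟩

theorem Sorted.eq_of_one (h : Λ.Sorted 1) (h' : Λ'.Sorted 1) : Λ = Λ' := by
  have key : ∀ t l, (Λ.line l).level t = (Λ'.line l).level t := by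
    intro t
    induction t using Fin.induction with
    | zero => intro l; rw [Λ.start, Λ'.start]
    | succ q ih =>
      intro l
      by_cases hl : (Λ.line l).level q.castSucc = N.upper q ∨
          (Λ.line l).level q.castSucc = N.lower q
      · obtain ⟨l', hm⟩ := Λ.exists_meets hl
        have hm' : Λ'.Meets l l' q := by
          unfold Meets at *
          rwa [← ih, ← ih]
        rcases lt_or_gt_of_ne hm.ne with hlt | hlt
        · rw [(h.level_succ hlt hm).1, (h'.level_succ hlt hm').1]
        · rw [(h.level_succ hlt hm.symm).2, (h'.level_succ hlt hm'.symm).2]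
      · push Not at hl
        rw [Λ.level_succ_of_ne hl.1 hl.2, Λ'.level_succ_of_ne (ih l ▸ hl.1) (ih l ▸ hl.2), ih]
  exact ext_level fun i t => key t i

/-- Among the positions of the crossing of `a` and `b` which flips can produce, some extreme one
makes all the contacts of `a` and `b` point from `b` to `a`. -/
theorem exists_isFlip_forall_not_isContact (Λ : N.Arrangement) {a b : Fin n} (hab : a ≠ b) :
    ∃ (Λ' : N.Arrangement) (k c : Fin m), CrossAt (Λ.line a) (Λ.line b) a b c ∧ Λ.Meets a b k ∧
      Λ.IsFlip Λ' a b k c ∧ ∀ q, ¬ Λ'.IsContact q a b := by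
  classical
  obtain ⟨c, hc⟩ := Λ.exists_crossAt hab
  let M : Finset (Fin m) := {q | Λ.Meets a b q}
  have hM : M.Nonempty := ⟨c, by simpa [M] using meets_of_crossAt hab hc⟩
  obtain ⟨k, hk, hext⟩ : ∃ k ∈ M, ∀ q ∈ M, q ≠ k → ¬ (b < a ↔ q < k) := by
    by_cases hba : b < a
    · refine ⟨M.min' hM, M.min'_mem hM, fun q hq _ => ?_⟩
      simpa only [hba, true_iff, not_lt] using M.min'_le q hq
    · refine ⟨M.max' hM, M.max'_mem hM, fun q hq hne => ?_⟩
      simpa only [hba, false_iff, not_not] using lt_of_le_of_ne (M.le_max' q hq) hne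
  have hk : Λ.Meets a b k := by simpa [M] using hk
  obtain ⟨Λ', h⟩ := exists_isFlip hc hk
  refine ⟨Λ', k, c, hc, hk, h, fun q hq => ?_⟩
  obtain ⟨h1, h2, h3⟩ := (isContact_iff hab (h.crossAt hab hc)).1 hq
  exact hext q (by simpa [M] using (h.meets_iff q).1 h1) h2 h3

/-- If `a` and `b` have consecutive values under `f`, flipping them carries an arrangement sorted
by `f` to one sorted by the order that exchanges these values. -/
theorem Sorted.of_isFlip {f : Equiv.Perm (Fin n)} (hf : Λ.Sorted f) {a b : Fin n} {k c : Fin m}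
    (hab : (f b : ℕ) = f a + 1) (hc : CrossAt (Λ.line a) (Λ.line b) a b c) (hk : Λ.Meets a b k)
    (h : Λ.IsFlip Λ' a b k c) (hno : ∀ q, ¬ Λ'.IsContact q a b) :
    Λ'.Sorted (f * Equiv.swap a b) := by
  intro q x y hq
  simp only [Equiv.Perm.mul_apply]
  rcases h.isContact hc hk hq with ⟨rfl, rfl⟩ | ⟨rfl, rfl⟩ | h1 | h1
  · exact absurd hq (hno q)
  · simp only [Equiv.swap_apply_left, Equiv.swap_apply_right, Fin.lt_def]
    omega
  · have hlt := hf q x y h1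
    have hne : ¬ (x = a ∧ y = b) := by
      rintro ⟨rfl, rfl⟩
      exact hno q hq
    have hb : ∀ u, u ≠ b → (f u : ℕ) ≠ f a + 1 := fun u hu e =>
      hu (f.injective (Fin.ext (e.trans hab.symm)))
    have ha : ∀ u, u ≠ a → (f u : ℕ) ≠ f a := fun u hu e => hu (f.injective (Fin.ext e))
    rw [Fin.lt_def] at *
    simp only [Equiv.swap_apply_def]
    grind
  · exact hf q _ _ h1

/-- Uniqueness passes from an order to the one which exchanges two consecutive values: flips map
the arrangements sorted by the former injectively to those sorted by the latter. -/
theorem Sorted.eq_of_mul_swap {f : Equiv.Perm (Fin n)} {a b : Fin n}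
    (hab : (f b : ℕ) = f a + 1)
    (huniq : ∀ Λ Λ' : N.Arrangement, Λ.Sorted (f * Equiv.swap a b) →
      Λ'.Sorted (f * Equiv.swap a b) → Λ = Λ')
    (h : Λ.Sorted f) (h' : Λ'.Sorted f) : Λ = Λ' := by
  have hne : a ≠ b := by
    rintro rfl
    omega
  obtain ⟨M, k, c, hc, hk, hflip, hno⟩ := Λ.exists_isFlip_forall_not_isContact hne
  obtain ⟨M', k', c', hc', hk', hflip', hno'⟩ := Λ'.exists_isFlip_forall_not_isContact hne
  obtain rfl := huniq M M' (h.of_isFlip hab hc hk hflip hno) (h'.of_isFlip hab hc' hk' hflip' hno')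
  obtain rfl : k = k' := (hflip.crossAt hne hc).unique (hflip'.crossAt hne hc')
  have hmeets : ∀ q, Λ.Meets a b q ↔ Λ'.Meets a b q := fun q =>
    (hflip.meets_iff q).symm.trans (hflip'.meets_iff q)
  by_cases hcc : c = c'
  · subst hcc
    exact ext_level fun i t => (hflip.symm i t).trans (hflip'.symm i t).symm
  · -- Otherwise the crossing of either arrangement is a contact of the other one, and these two
    -- contacts have opposite directions, of which `f` admits only one.
    exfalso
    have m1 := (hmeets c').2 (meets_of_crossAt hne hc')
    have m2 := (hmeets c).1 (meets_of_crossAt hne hc)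
    have n1 : ¬ Λ.IsContact c' b a := fun hq => by
      have := h _ _ _ hq
      rw [Fin.lt_def] at this
      omega
    have n2 : ¬ Λ'.IsContact c b a := fun hq => by
      have := h' _ _ _ hq
      rw [Fin.lt_def] at this
      omega
    rw [isContact_iff hne.symm ((crossAt_comm hne).1 hc)] at n1
    rw [isContact_iff hne.symm ((crossAt_comm hne).1 hc')] at n2
    have n1 : ¬ (a < b ↔ c' < c) := fun e => n1 ⟨m1.symm, Ne.symm hcc, e⟩
    have n2 : ¬ (a < b ↔ c < c') := fun e => n2 ⟨m2.symm, hcc, e⟩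
    simp only [Fin.ext_iff, Fin.lt_def] at *
    omega

/-- For every linear order on the labels, at most one arrangement is sorted by it. -/
theorem Sorted.eq {f : Equiv.Perm (Fin n)} (h : Λ.Sorted f) (h' : Λ'.Sorted f) : Λ = Λ' := by
  cases n with
  | zero => exact ext_level fun i => i.elim0
  | succ n =>
  have hf : f ∈ Submonoid.closure
      (Set.range fun i : Fin n => Equiv.swap i.castSucc i.succ) := by
    rw [Equiv.Perm.mclosure_swap_castSucc_succ]
    trivial
  induction hf using Submonoid.closure_induction_left generalizing Λ Λ' with
  | one => exact h.eq_of_one h'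
  | mul_left x hx g _ ih =>
    obtain ⟨i, rfl⟩ := hx
    have hg : Equiv.swap i.castSucc i.succ * g * Equiv.swap (g⁻¹ i.succ) (g⁻¹ i.castSucc) = g := by
      ext z
      simp only [Equiv.Perm.mul_apply, Equiv.swap_apply_def, Equiv.Perm.eq_inv_iff_eq]
      split_ifs <;> simp_all
    -- The product takes the value `i` where `g` takes `i + 1`, and conversely.
    refine Sorted.eq_of_mul_swap (a := g⁻¹ i.succ) (b := g⁻¹ i.castSucc) ?_ ?_ h h'
    · simp
    · rw [hg]
      exact fun _ _ => ih

end Arrangement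
end Network

/-! ### Brick vectors and flips -/

namespace Network

variable {n m : ℕ} {N : Network n m}

namespace Arrangement

variable {Λ Λ' : N.Arrangement}

open Classical in
theorem brickVector_eq (Λ : N.Arrangement) (i : Fin n) :
    Λ.brickVector i =
      (({b : Fin m × Fin m | N.IsBrick b ∧ N.upper b.1 ≤ (Λ.line i).level b.1.succ} :
        Finset (Fin m × Fin m)).card : ℝ) := by
  rw [brickVector, ← Set.ncard_coe_finset]
  congr 2
  ext b
  simp only [Finset.coe_filter, Finset.mem_univ, true_and, Set.mem_ofPred_eq]
  exact and_congr_right fun hb => Pseudoline.isAbove_iff _ hb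

/-- If a pseudoline of one arrangement passes above the level gap of the commutator `p` just after
`p`, and a pseudoline of another one below, while both end on the same level, then `p` is the left
end of a brick. -/
theorem exists_isBrick {x y : N.Pseudoline} (hlast : x.level (Fin.last m) = y.level (Fin.last m))
    {p : Fin m} (hx : N.upper p ≤ x.level p.succ) (hy : ¬ N.upper p ≤ y.level p.succ) :
    ∃ r, N.IsBrick (p, r) := by
  classical
  let M : Finset (Fin m) := {q | p < q ∧ N.lower p = N.lower q}
  have hM : M.Nonempty := by
    by_contra hne
    have hno : ∀ q, p < q → q.castSucc < Fin.last m → N.lower q ≠ N.lower p := fun q hq _ he =>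
      hne ⟨q, by simp [M, hq, he]⟩
    rw [← x.upper_le_level_iff (Fin.castSucc_lt_last p) hno, hlast,
      y.upper_le_level_iff (Fin.castSucc_lt_last p) hno] at hx
    exact hy hx
  have hr := M.min'_mem hM
  simp only [M, Finset.mem_filter, Finset.mem_univ, true_and] at hr
  refine ⟨M.min' hM, hr.1, hr.2, fun q h1 h2 he => ?_⟩
  exact (M.min'_le q (by simp [M, h1, he])).not_gt h2

/-- Flipping a contact from `i` to `j` moves a positive number of bricks from below `i` to
below `j`. -/
theorem exists_brickVector_eq_add {k : Fin m} {i j : Fin n} (hk : Λ.IsContact k i j) :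
    ∃ (Λ' : N.Arrangement) (μ : ℝ), 0 < μ ∧
      Λ'.brickVector = Λ.brickVector + μ • (Pi.single j 1 - Pi.single i 1) := by
  classical
  have hij := hk.meets.ne
  obtain ⟨c, hc⟩ := Λ.exists_crossAt hij
  obtain ⟨Λ', h⟩ := exists_isFlip hc hk.meets
  obtain ⟨-, hkc, hside⟩ := (isContact_iff hij hc).1 hk
  -- Wherever the two pseudolines are exchanged, `i` runs above `j`, as it does at `k`.
  have inside : ∀ t, tailSwap i j k c t = 1 ∨
      (tailSwap i j k c t = Equiv.swap i j ∧ (Λ.line j).level t < (Λ.line i).level t) := by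
    intro t
    have h1 := hc t
    have h2 := Λ.disjoint i j hij t
    unfold tailSwap
    split_ifs with h3
    · refine .inr ⟨rfl, ?_⟩
      simp only [Fin.ext_iff, ne_eq, Fin.lt_def, Fin.le_def, Fin.val_castSucc,
        Fin.coe_min, Fin.coe_max] at *
      omega
    · exact .inl rfl
  let S : N.Arrangement → Fin n → Finset (Fin m × Fin m) := fun Λ l =>
    {b | N.IsBrick b ∧ N.upper b.1 ≤ (Λ.line l).level b.1.succ}
  -- The bricks between the two pseudolines, over the interval where they are exchanged.
  let D : Finset (Fin m × Fin m) := {b | N.IsBrick b ∧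
    tailSwap i j k c b.1.succ = Equiv.swap i j ∧
    N.upper b.1 ≤ (Λ.line i).level b.1.succ ∧ ¬ N.upper b.1 ≤ (Λ.line j).level b.1.succ}
  have hsw : (1 : Equiv.Perm (Fin n)) ≠ Equiv.swap i j := fun e => hij <| by
    have := congrArg (· i) e
    simpa using this
  have hDi : D ⊆ S Λ i := by
    intro b hb
    simp only [D, S, Finset.mem_filter, Finset.mem_univ, true_and] at *
    exact ⟨hb.1, hb.2.2.1⟩
  have hDj : Disjoint D (S Λ j) := by
    rw [Finset.disjoint_left]
    intro b hb
    simp only [D, S, Finset.mem_filter, Finset.mem_univ, true_and] at *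
    exact fun h => hb.2.2.2 h.2
  have hSi : S Λ' i = S Λ i \ D := by
    ext b
    simp only [D, S, Finset.mem_filter, Finset.mem_univ, true_and, Finset.mem_sdiff, h i]
    rcases inside b.1.succ with e | ⟨e, hlt⟩
    · simp [e, hsw]
    · simp only [e, Equiv.swap_apply_left]
      have : N.upper b.1 ≤ (Λ.line j).level b.1.succ →
        N.upper b.1 ≤ (Λ.line i).level b.1.succ := fun h => h.trans hlt.le
      tauto
  have hSj : S Λ' j = S Λ j ∪ D := by
    ext b
    simp only [D, S, Finset.mem_filter, Finset.mem_univ, true_and, Finset.mem_union, h j]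
    rcases inside b.1.succ with e | ⟨e, hlt⟩
    · simp [e, hsw]
    · simp only [e, Equiv.swap_apply_right]
      have : N.upper b.1 ≤ (Λ.line j).level b.1.succ →
        N.upper b.1 ≤ (Λ.line i).level b.1.succ := fun h => h.trans hlt.le
      tauto
  have hS : ∀ l, l ≠ i → l ≠ j → S Λ' l = S Λ l := by
    intro l hi hj
    simp only [S, h l, tailSwap_apply_of_ne hi hj]
  -- The exchange starts at the commutator `min k c`. It is the left end of a brick, because it
  -- separates two pseudolines that end on the same level.
  have hD : 0 < D.card := by
    rw [Finset.card_pos]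
    have hm : Λ.Meets i j (min k c) := by
      rcases min_choice k c with e | e <;> rw [e]
      exacts [hk.meets, meets_of_crossAt hij hc]
    have he : tailSwap i j k c (min k c).succ = Equiv.swap i j := by
      unfold tailSwap
      rw [if_pos ⟨Fin.castSucc_lt_succ, Fin.succ_le_castSucc_iff.2 (min_lt_max.2 hkc)⟩]
    have hlt : (Λ.line j).level (min k c).succ < (Λ.line i).level (min k c).succ := by
      rcases inside (min k c).succ with e | e
      · exact absurd (e.symm.trans he) hsw
      · exact e.2
    have hu : N.upper (min k c) ≤ (Λ.line i).level (min k c).succ ∧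
        ¬ N.upper (min k c) ≤ (Λ.line j).level (min k c).succ := by
      have h1 := hm.succ
      have h2 := N.upper_eq (min k c)
      simp only [Fin.ext_iff, Fin.lt_def, Fin.le_def] at *
      omega
    obtain ⟨r, hr⟩ := exists_isBrick (x := Λ.line i) (y := Λ'.line i) (p := min k c)
      (by rw [h, tailSwap_last]; rfl) hu.1 (by rw [h, he, Equiv.swap_apply_left]; exact hu.2)
    exact ⟨(min k c, r), by simpa [D, hr, he] using hu⟩
  refine ⟨Λ', D.card, by exact_mod_cast hD, ?_⟩
  have hb : ∀ (Λ : N.Arrangement) l, Λ.brickVector l = ((S Λ l).card : ℝ) := fun Λ l => by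
    rw [brickVector_eq]
  funext l
  simp only [hb, Pi.add_apply, Pi.smul_apply, Pi.sub_apply, smul_eq_mul]
  by_cases hi : l = i
  · subst hi
    rw [hSi, Finset.cast_card_sdiff hDi]
    simp [hij]
    ring
  by_cases hj : l = j
  · subst hj
    rw [hSj, Finset.card_union_of_disjoint hDj.symm]
    simp [hij.symm]
  · simp [hS l hi hj, hi, hj]

end Arrangement
end Network

/-! ### Extreme points and topological sortings -/

/-- A point of `S` at which a linear functional is smallest, strictly so among the points of `S`, is
an extreme point of the convex hull. -/
theorem mem_extremePoints_convexHull_of_forall_lt {E : Type*} [AddCommGroup E] [Module ℝ E]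
    {S : Set E} {x₀ : E} (L : E →ₗ[ℝ] ℝ) (h₀ : x₀ ∈ S) (h : ∀ x ∈ S, x = x₀ ∨ L x₀ < L x) :
    x₀ ∈ Set.extremePoints ℝ (convexHull ℝ S) := by
  -- The point together with an open half-space with this point on its boundary is convex.
  have hconv : Convex ℝ {x | x = x₀ ∨ L x₀ < L x} := by
    rintro x hx y hy a b ha hb hab
    simp only [Set.mem_ofPred_eq, map_add, map_smul, smul_eq_mul] at *
    obtain rfl : b = 1 - a := by linarith
    rcases hx with rfl | hx
    · rcases hy with rfl | hy
      · left
        rw [← add_smul, hab, one_smul]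
      · rcases hb.eq_or_lt with hb0 | hb0
        · left
          rw [← hb0, show a = 1 by linarith]
          simp
        · right
          nlinarith
    · rcases ha.eq_or_lt with ha0 | ha0
      · subst ha0
        simpa using hy
      · right
        rcases hy with rfl | hy
        · nlinarith
        · nlinarith
  have hsub : convexHull ℝ S ⊆ {x | x = x₀ ∨ L x₀ < L x} := convexHull_min h hconv
  refine ⟨subset_convexHull ℝ S h₀, fun x hx y hy hxy => ?_⟩
  obtain ⟨a, b, ha, hb, hab, he⟩ := hxy
  have hL := congrArg L he
  simp only [map_add, map_smul, smul_eq_mul] at hL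
  obtain rfl : b = 1 - a := by linarith
  rcases hsub hx with rfl | hx'
  · rfl
  · exfalso
    rcases hsub hy with rfl | hy' <;> nlinarith

/-- An acyclic directed multigraph with `n` nodes has a topological sorting. -/
theorem Quiver.IsAcyclic.exists_equiv_fin {V : Type*} [Fintype V] {n : ℕ}
    (hn : Fintype.card V = n) {G : Quiver V} (hG : G.IsAcyclic) :
    ∃ f : V ≃ Fin n, ∀ i j, Nonempty (G.Hom i j) → f i < f j := by
  have hanti : ∀ (i j : V) (p : G.Path i j) (_ : G.Path j i), p.length = 0 := fun i j p q => by
    have h := hG i (p.comp q)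
    rw [Quiver.Path.length_comp] at h
    omega
  let : PartialOrder V :=
    { le := fun i j => Nonempty (G.Path i j)
      le_refl := fun i => ⟨.nil⟩
      le_trans := fun _ _ _ ⟨p⟩ ⟨q⟩ => ⟨p.comp q⟩
      le_antisymm := fun i j ⟨p⟩ ⟨q⟩ => Quiver.Path.eq_of_length_zero p (hanti i j p q) }
  let : Fintype (LinearExtension V) := ‹Fintype V›
  let e : Fin n ≃o LinearExtension V := monoEquivOfFin _ hn
  refine ⟨e.symm.toEquiv, fun i j ⟨a⟩ => lt_of_le_of_ne ?_ fun h => ?_⟩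
  · exact e.symm.monotone (toLinearExtension.monotone ⟨a.toPath⟩)
  · obtain rfl : i = j := e.symm.injective h
    have := hG i a.toPath
    simp at this

namespace Network

variable {n m : ℕ} {N : Network n m}

namespace Arrangement

variable {Λ Λ' : N.Arrangement}

theorem brickVector_mem_brickPolytope (Λ : N.Arrangement) : Λ.brickVector ∈ N.brickPolytope :=
  subset_convexHull ℝ _ ⟨Λ, rfl⟩

/-- An arrangement that is sorted by `f` is the only one whose brick vector minimizes the linear
functional with coefficients `f`. -/
theorem Sorted.sum_lt {f : Equiv.Perm (Fin n)} (h : Λ.Sorted f) (hne : Λ' ≠ Λ) :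
    ∑ i, (f i : ℝ) * Λ.brickVector i < ∑ i, (f i : ℝ) * Λ'.brickVector i := by
  have : Nonempty N.Arrangement := ⟨Λ⟩
  have hmin : ∀ M : N.Arrangement,
      (∀ M' : N.Arrangement,
        ∑ i, (f i : ℝ) * M.brickVector i ≤ ∑ i, (f i : ℝ) * M'.brickVector i) → M = Λ := by
    intro M hM
    refine Sorted.eq (f := f) (fun k i j hk => ?_) h
    by_contra hlt
    have hij : f j < f i := lt_of_le_of_ne (not_lt.1 hlt) (f.injective.ne hk.meets.ne.symm)
    obtain ⟨M', μ, hμ, he⟩ := exists_brickVector_eq_add hk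
    have hM' := hM M'
    simp only [he, Pi.add_apply, Pi.smul_apply, Pi.sub_apply, smul_eq_mul, mul_add, mul_sub,
      Finset.sum_add_distrib, Finset.sum_sub_distrib, Pi.single_apply, mul_ite, mul_one, mul_zero,
      Finset.sum_ite_eq', Finset.mem_univ, if_true] at hM'
    have hij' : ((f j : ℕ) : ℝ) < f i := by exact_mod_cast hij
    nlinarith
  obtain ⟨M, hM⟩ := Finite.exists_min fun M : N.Arrangement => ∑ i, (f i : ℝ) * M.brickVector i
  obtain rfl := hmin M hM
  refine lt_of_le_of_ne (hM Λ') fun heq => hne (hmin Λ' fun M' => ?_)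
  rw [← heq]
  exact hM M'

/-- Along a nontrivial directed path of the contact graph, flips move bricks from below its source
to below its target: the corresponding direction points into the brick polytope. -/
theorem exists_mem_brickPolytope_of_path {i j : Fin n}
    (p : Λ.contactGraph.Path i j) (hp : i ≠ j) :
    ∃ μ : ℝ, 0 < μ ∧
      Λ.brickVector + μ • (Pi.single j 1 - Pi.single i 1) ∈ N.brickPolytope := by
  induction p with
  | nil => exact absurd rfl hp
  | @cons b c p e ih =>
    obtain ⟨k, hk⟩ := e
    obtain ⟨Λ', μ, hμ, he⟩ := exists_brickVector_eq_add hk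
    have h1 := Λ'.brickVector_mem_brickPolytope
    rw [he] at h1
    by_cases hib : i = b
    · subst hib
      exact ⟨μ, hμ, h1⟩
    · obtain ⟨ν, hν, h2⟩ := ih hib
      refine ⟨μ * ν / (μ + ν), by positivity, ?_⟩
      refine convex_convexHull ℝ _ |>.segment_subset h1 h2 ⟨ν / (μ + ν), μ / (μ + ν), by positivity,
        by positivity, by field_simp; ring, ?_⟩
      funext l
      simp only [Pi.add_apply, Pi.smul_apply, Pi.sub_apply, smul_eq_mul]
      field_simp
      ring

end Arrangement
end Network

open Network Arrangement in
theorem mainTheorem2 {n m : ℕ} (N : Network n m) (Λ : N.Arrangement) :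
    Λ.brickVector ∈ Set.extremePoints ℝ N.brickPolytope ↔ Λ.contactGraph.IsAcyclic := by
  constructor
  · intro hext v p
    cases p with
    | nil => rfl
    | @cons w _ p e =>
      exfalso
      obtain ⟨k, hk⟩ := e
      have hwv := hk.meets.ne
      obtain ⟨ν, hν, h1⟩ := exists_mem_brickPolytope_of_path p hwv.symm
      obtain ⟨Λ', μ, hμ, he⟩ := exists_brickVector_eq_add hk
      have h2 := Λ'.brickVector_mem_brickPolytope
      -- The brick vector lies strictly between these two points.
      have h3 := hext.2 h1 h2 ⟨μ / (μ + ν), ν / (μ + ν), by positivity, by positivity,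
        by field_simp, by
          rw [he]
          funext l
          simp only [Pi.add_apply, Pi.smul_apply, Pi.sub_apply, smul_eq_mul]
          field_simp
          ring⟩
      have h4 := congrFun h3 w
      simp [hwv] at h4
      exact hν.ne' h4
  · intro hac
    obtain ⟨f, hf⟩ := hac.exists_equiv_fin (Fintype.card_fin n)
    have hs : Λ.Sorted f := fun k i j hk => hf i j ⟨⟨k, hk⟩⟩
    refine mem_extremePoints_convexHull_of_forall_lt
      (∑ i, (f i : ℝ) • LinearMap.proj (R := ℝ) (φ := fun _ : Fin n => ℝ) i) ⟨Λ, rfl⟩ ?_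
    rintro _ ⟨Λ', rfl⟩
    by_cases hne : Λ' = Λ
    · exact .inl (hne ▸ rfl)
    · right
      simpa [LinearMap.sum_apply] using hs.sum_lt hne
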